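/- Let $\mathbb P^w$ be the complex weighted projective space of weights $(2,3,2,3,1)$ with coordinates $[x_2:x_3:y_2:y_3:y_1]$, and identify its chart $y_1\neq 0$ with $\mathbb C^4$, with coordinates $(x_2,x_3,y_2,y_3)$, by normalizing $y_1=1$. Let $$\mathsf v=\left(2x_2-6x_3+\tfrac16(x_2-y_2)x_2\right)\tfrac{\partial}{\partial x_2}+\left(3x_3-\tfrac13x_2^2+\tfrac14(x_2-y_2)x_3\right)\tfrac{\partial}{\partial x_3}-\left(2y_2-6y_3+\tfrac16(y_2-x_2)y_2\right)\tfrac{\partial}{\partial y_2}-\left(3y_3-\tfrac13y_2^2+\tfrac14(y_2-x_2)y_3\right)\tfrac{\partial}{\partial y_3}$$ and $g:\mathbb P^1\to\mathbb P^w$, $g([t:s])=[3t^2:t^3:3s^2:s^3:\tfrac12(s+t)]$. Let $(g_1,g_2,g_3)=\left(\tfrac{2\pi i}{12}E_2,\,12(\tfrac{2\pi i}{12})^2E_4,\,8(\tfrac{2\pi i}{12})^3E_6\right)$, where $E_2,E_4,E_6$ are the Eisenstein series of level one with constant term $1$. For $d\in\mathbb N$ let $S_0(d)\subset\mathbb P^w$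 be the closure of the image of the upper half plane under $$\tau\mapsto[g_2(\tau):g_3(\tau):d^2g_2(d\tau):-d^3g_3(d\tau):g_1(\tau)-d\,g_1(d\tau)].$$ Let $\psi(d)=d\prod_{p\mid d}(1+\tfrac1p)$. For $i=1,2,3$ let $\alpha_{i,1},\dots,\alpha_{i,m_{d,i}}$ be the monomials $y_i^{a_1}x_2^{a_2}x_3^{a_3}$ with $a_1,a_2,a_3\in\mathbb N_0$ and $ia_1+2a_2+3a_3=i\,\psi(d)$. Let $Q_{d,i}=\sum_j c_{i,j}\alpha_{i,j}$, $c_{i,j}\in\mathbb Q$, be the polynomial of this form that vanishes on $S_0(d)$ and has coefficient $1$ at $y_i^{\psi(d)}$, and let $C_{d,i}$ be the column vector with entries $c_{i,1},\dots,c_{i,m_{d,i}}$. Let $B_{d,i}$ be the $m_{d,i}\times m_{d,i}$ matrix of polynomials in $x_2,x_3,y_2,y_3$ whose rows are $\left(\mathsf v^k(\alpha_{i,1}),\dots,\mathsf v^k(\alpha_{i,m_{d,i}})\right)$, $k=0,\dots,m_{d,i}-1$ (with $y_1=1$ in the monomials for $i=1$). Let $d=ab$ with $a,b\in\mathbb N$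 positive, $b<a$, let $r:=\frac ab$ and $p:=g([1:-r])=g([b:-a])$, which lies in the chart $y_1\neq0$. Then for $i=1,2,3$ $$\left(\frac{\partial B_{d,i}}{\partial x_2}(p)\cdot(6-5r)(1-r)+\frac{\partial B_{d,i}}{\partial x_3}(p)\cdot(7r-6)+\frac{\partial B_{d,i}}{\partial y_2}(p)\cdot r^2(1-r)-\frac{\partial B_{d,i}}{\partial y_3}(p)\cdot r^3\right)C_{d,i}=0.$$ -/

import Mathlib

noncomputable section

namespace ModularFoliation

open UpperHalfPlane MvPolynomial

/-! ## The weighted projective space of weights (2,3,2,3,1)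

Homogeneous coordinates are listed in the order `[x₂ : x₃ : y₂ : y₃ : y₁]`,
that is `x₂ = z 0`, `x₃ = z 1`, `y₂ = z 2`, `y₃ = z 3`, `y₁ = z 4`. -/

/-- The weights of the coordinates `x₂, x₃, y₂, y₃, y₁`. -/
def weight : Fin 5 → ℕ := ![2, 3, 2, 3, 1]

/-- Two nonzero vectors are equivalent if they differ by the weighted action of a nonzero
scalar. -/
def weightedSetoid : Setoid {z : Fin 5 → ℂ // z ≠ 0} where
  r z w := ∃ l : ℂ, l ≠ 0 ∧ ∀ k, w.1 k = l ^ weight k * z.1 k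
  iseqv :=
    { refl := fun z => ⟨1, one_ne_zero, fun k => by simp⟩
      symm := by
        rintro z w ⟨l, hl, h⟩
        refine ⟨l⁻¹, inv_ne_zero hl, fun k => ?_⟩
        rw [h k, inv_pow, inv_mul_cancel_left₀ (pow_ne_zero _ hl)]
      trans := by
        rintro z w u ⟨l, hl, h⟩ ⟨m, hm, h'⟩
        refine ⟨m * l, mul_ne_zero hm hl, fun k => ?_⟩
        rw [h' k, h k, mul_pow, mul_assoc] }

/-- The complex weighted projective space of weights `(2,3,2,3,1)`. -/
def WProj : Type := Quotient weightedSetoid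

/-- The quotient topology. -/
instance : TopologicalSpace WProj :=
  inferInstanceAs (TopologicalSpace (Quotient weightedSetoid))

/-- The point with homogeneous coordinates `z`. -/
def WProj.mk (z : Fin 5 → ℂ) (hz : z ≠ 0) : WProj :=
  Quotient.mk weightedSetoid ⟨z, hz⟩

/-- The affine coordinates `(x₂, x₃, y₂, y₃)` of a point of the chart `y₁ ≠ 0`; in this chart
the representative is normalized by `y₁ = 1`. (The value is irrelevant if `y₁ = 0`.) -/
def WProj.affine : WProj → Fin 4 → ℂ :=
  Quotient.lift
    (fun z => ![z.1 0 / z.1 4 ^ 2, z.1 1 / z.1 4 ^ 3, z.1 2 / z.1 4 ^ 2, z.1 3 / z.1 4 ^ 3])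
    (by
      rintro z w ⟨l, hl, h⟩
      have h0 := h 0
      have h1 := h 1
      have h2 := h 2
      have h3 := h 3
      have h4 := h 4
      simp [weight] at h0 h1 h2 h3 h4
      have key : ∀ (n : ℕ) (u : ℂ), l ^ n * u / (l * z.1 4) ^ n = u / z.1 4 ^ n := by
        intro n u
        rw [mul_pow, mul_div_mul_left _ _ (pow_ne_zero n hl)]
      simp only [h0, h1, h2, h3, h4, key])

/-- The parametrized rational curve
`[t : s] ↦ [3t² : t³ : 3s² : s³ : (s + t)/2]` of singular points. -/
def g (t s : ℂ) (h : t ≠ 0 ∨ s ≠ 0) : WProj :=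
  WProj.mk ![3 * t ^ 2, t ^ 3, 3 * s ^ 2, s ^ 3, (s + t) / 2] (by
    intro h0
    have h1 := congrFun h0 1
    have h3 := congrFun h0 3
    simp at h1 h3
    rcases h with h | h
    · exact h h1
    · exact h h3)

/-! ## Eisenstein series and the curve `S₀(d)` -/

/-- The normalized Eisenstein series `g₁ = (2πi/12) E₂`. -/
def g₁ (τ : ℍ) : ℂ := (2 * Real.pi * Complex.I / 12) * EisensteinSeries.E2 τ

/-- The normalized Eisenstein series `g₂ = 12 (2πi/12)² E₄`. -/
def g₂ (τ : ℍ) : ℂ :=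
  12 * (2 * Real.pi * Complex.I / 12) ^ 2 * ModularForm.E (k := 4) (by norm_num) τ

/-- The normalized Eisenstein series `g₃ = 8 (2πi/12)³ E₆`. -/
def g₃ (τ : ℍ) : ℂ :=
  8 * (2 * Real.pi * Complex.I / 12) ^ 3 * ModularForm.E (k := 6) (by norm_num) τ

/-- The point `d · τ` of the upper half plane. -/
def dilate (d : ℕ+) (τ : ℍ) : ℍ :=
  ⟨(d : ℂ) * (τ : ℂ), by
    have h : ((d : ℂ) * (τ : ℂ)).im = (d : ℝ) * τ.im := by simp
    rw [h]
    exact mul_pos (by exact_mod_cast d.pos) τ.im_pos⟩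

/-- Homogeneous coordinates of the point of `S₀(d)` given by `τ`:
`[g₂(τ) : g₃(τ) : d² g₂(dτ) : -d³ g₃(dτ) : g₁(τ) - d g₁(dτ)]`. -/
def modularVec (d : ℕ+) (τ : ℍ) : Fin 5 → ℂ :=
  ![g₂ τ, g₃ τ, (d : ℂ) ^ 2 * g₂ (dilate d τ), -((d : ℂ) ^ 3 * g₃ (dilate d τ)),
    g₁ τ - (d : ℂ) * g₁ (dilate d τ)]

/-- The curve `S₀(d)`: the closure in the weighted projective space of the image of the
modular parametrization (the closure adds the images of the cusps). -/
def S₀ (d : ℕ+) : Set WProj :=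
  closure {P | ∃ (τ : ℍ) (h : modularVec d τ ≠ 0), P = WProj.mk (modularVec d τ) h}

/-! ## The monomials, the polynomials `Q_{d,i}` and the matrices `B_{d,i}` -/

/-- The Dedekind function `ψ(d) = d ∏_{p ∣ d} (1 + 1/p)`, written without fractions. -/
def psi (d : ℕ) : ℕ := (d / ∏ p ∈ d.primeFactors, p) * ∏ p ∈ d.primeFactors, (p + 1)

theorem psi_eq (d : ℕ) : (psi d : ℚ) = d * ∏ p ∈ d.primeFactors, (1 + 1 / (p : ℚ)) := by
  have hne : ∀ p ∈ d.primeFactors, (p : ℚ) ≠ 0 := fun p hp => by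
    exact_mod_cast (Nat.prime_of_mem_primeFactors hp).ne_zero
  have h0 : ((∏ p ∈ d.primeFactors, p : ℕ) : ℚ) ≠ 0 := by
    push_cast
    exact Finset.prod_ne_zero_iff.mpr hne
  have h1 : ∏ p ∈ d.primeFactors, (1 + 1 / (p : ℚ)) =
      (∏ p ∈ d.primeFactors, ((p : ℚ) + 1)) / ∏ p ∈ d.primeFactors, (p : ℚ) := by
    rw [← Finset.prod_div_distrib]
    refine Finset.prod_congr rfl fun p hp => ?_
    have := hne p hp
    field_simp
  rw [psi, Nat.cast_mul, Nat.cast_div (Nat.prod_primeFactors_dvd d) h0, h1]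
  push_cast
  ring

/-- The exponents `(a₁, a₂, a₃)` with `i a₁ + 2 a₂ + 3 a₃ = i ψ(d)` (the bounds on the `aⱼ` are
automatic for `i ≥ 1`). They index the monomials `α_{i,j}`. -/
def expSet (d : ℕ+) (i : ℕ) : Finset (ℕ × ℕ × ℕ) :=
  (Finset.range (i * psi d + 1) ×ˢ Finset.range (i * psi d + 1) ×ˢ
    Finset.range (i * psi d + 1)).filter
      fun e => i * e.1 + 2 * e.2.1 + 3 * e.2.2 = i * psi d

/-- The position of the homogeneous coordinate `y_i`, for `i = 1, 2, 3`. -/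
def yIdx (i : ℕ) : Fin 5 := if i = 1 then 4 else if i = 2 then 2 else 3

/-- The monomial `y_i ^ a₁ * x₂ ^ a₂ * x₃ ^ a₃` in the homogeneous coordinates. -/
def homMonomial (i : ℕ) (e : ℕ × ℕ × ℕ) : MvPolynomial (Fin 5) ℚ :=
  X (yIdx i) ^ e.1 * X 0 ^ e.2.1 * X 1 ^ e.2.2

/-- The polynomial `Q = ∑ⱼ cⱼ α_{i,j}` with coefficient vector `c`. -/
def Qpoly (d : ℕ+) (i : ℕ) (c : expSet d i → ℚ) : MvPolynomial (Fin 5) ℚ :=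
  ∑ e, C (c e) * homMonomial i e.1

/-- The vector `c` is the coefficient vector `C_{d,i}` of `Q_{d,i}`: the weighted homogeneous
polynomial with coefficients `c` vanishes on `S₀(d)`, and its coefficient of `y_i ^ ψ(d)`
is `1`. -/
structure IsCoeffVector (d : ℕ+) (i : ℕ) (c : expSet d i → ℚ) : Prop where
  coeff_eq_one : (Qpoly d i c).coeff (Finsupp.single (yIdx i) (psi d)) = 1
  vanishes : ∀ (z : Fin 5 → ℂ) (hz : z ≠ 0), WProj.mk z hz ∈ S₀ d → aeval z (Qpoly d i c) = 0

/-- The monomial `α_{i,j}` in the affine chart, that is in `ℚ[x₂, x₃, y₂, y₃]`, with `y₁ = 1`. -/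
def alpha (i : ℕ) (e : ℕ × ℕ × ℕ) : MvPolynomial (Fin 4) ℚ :=
  aeval ![X 0, X 1, X 2, X 3, 1] (homMonomial i e)

/-- The vector field `v` as a derivation of `ℚ[x₂, x₃, y₂, y₃]`. -/
def v : Derivation ℚ (MvPolynomial (Fin 4) ℚ) (MvPolynomial (Fin 4) ℚ) :=
  let x₂ : MvPolynomial (Fin 4) ℚ := X 0
  let x₃ : MvPolynomial (Fin 4) ℚ := X 1
  let y₂ : MvPolynomial (Fin 4) ℚ := X 2
  let y₃ : MvPolynomial (Fin 4) ℚ := X 3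
  mkDerivation ℚ
    ![2 * x₂ - 6 * x₃ + C (1 / 6) * (x₂ - y₂) * x₂,
      3 * x₃ - C (1 / 3) * x₂ ^ 2 + C (1 / 4) * (x₂ - y₂) * x₃,
      -(2 * y₂ - 6 * y₃ + C (1 / 6) * (y₂ - x₂) * y₂),
      -(3 * y₃ - C (1 / 3) * y₂ ^ 2 + C (1 / 4) * (y₂ - x₂) * y₃)]

/-- The square matrix `B_{d,i}`, whose rows are `v^k(α_{i,1}), v^k(α_{i,2}), …` for
`k = 0, …, m_{d,i} - 1`. -/
def B (d : ℕ+) (i : ℕ) :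
    Matrix (Fin (expSet d i).card) (expSet d i) (MvPolynomial (Fin 4) ℚ) :=
  Matrix.of fun k e => (⇑v)^[(k : ℕ)] (alpha i e.1)

/-- The entrywise partial derivative of `B_{d,i}` with respect to the `k`-th of the variables
`x₂, x₃, y₂, y₃`, evaluated at `p`. -/
def dB (d : ℕ+) (i : ℕ) (k : Fin 4) (p : Fin 4 → ℂ) :
    Matrix (Fin (expSet d i).card) (expSet d i) ℂ :=
  (B d i).map fun f => aeval p (pderiv k f)

end ModularFoliation

end

noncomputable section

namespace ModularFoliation

open UpperHalfPlane MvPolynomial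

/-! ## Directional derivatives at a singular point -/

/-! The combination of partial derivatives of `B` is the derivative at p in the direction w =
`branchDirection r`, so the k-th entry of the product is that derivative applied to v^k(Q), with Q =
`affineQ`. Two facts make it vanish.

Algebraic: v vanishes at p, and w is an eigenvector of its linear part with eigenvalue 12/(1 - r)
(`dirDeriv_singularPoint_v`). By `dirDeriv_iterate_derivation` the k-th entry is therefore (12/(1 -
r))^k times the derivative of Q itself along w. Tangency of v to the modular curve is not needed.

Analytic: near the cusp 1/a the curve has a branch through p with tangent w
(`ofAffine_branch_mem_S₀`, `hasDerivAt_branch`). It is parametrized by x = exp(2πiτ), while the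
second Eisenstein argument has nome a root of unity times x^(a/b). Since a/b > 1, that nome does not
contribute to first order, and w comes from the q-coefficients -24, 240, -504 of E₂, E₄, E₆. As Q is
zero on the branch, its derivative along w is zero (`dirDeriv_affineQ_eq_zero`). -/

/-- The derivative of `P` at the point `p` in the direction `w`. -/
def dirDeriv {σ : Type*} [Fintype σ] (p w : σ → ℂ) (P : MvPolynomial σ ℚ) : ℂ :=
  ∑ j, w j * aeval p (pderiv j P)

section dirDeriv

variable {σ : Type*} [Fintype σ] (p w : σ → ℂ)

theorem dirDeriv_add (P Q : MvPolynomial σ ℚ) :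
    dirDeriv p w (P + Q) = dirDeriv p w P + dirDeriv p w Q := by
  simp [dirDeriv, mul_add, Finset.sum_add_distrib]

theorem dirDeriv_mul (P Q : MvPolynomial σ ℚ) :
    dirDeriv p w (P * Q) = dirDeriv p w P * aeval p Q + aeval p P * dirDeriv p w Q := by
  simp only [dirDeriv, Derivation.leibniz, map_add, smul_eq_mul, map_mul, mul_add,
    Finset.sum_add_distrib, Finset.sum_mul, Finset.mul_sum]
  rw [add_comm]
  congr 1 <;> exact Finset.sum_congr rfl fun j _ => by ring

@[simp]
theorem dirDeriv_C (x : ℚ) : dirDeriv p w (C x) = 0 := by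
  simp [dirDeriv]

@[simp]
theorem dirDeriv_X [DecidableEq σ] (i : σ) : dirDeriv p w (X i) = w i := by
  simp [dirDeriv, pderiv_X, Pi.single_apply, apply_ite]

theorem dirDeriv_C_mul (x : ℚ) (P : MvPolynomial σ ℚ) :
    dirDeriv p w (C x * P) = x * dirDeriv p w P := by
  simp [dirDeriv_mul]

theorem dirDeriv_sum {ι : Type*} (s : Finset ι) (f : ι → MvPolynomial σ ℚ) :
    dirDeriv p w (∑ e ∈ s, f e) = ∑ e ∈ s, dirDeriv p w (f e) := by
  classical
  induction s using Finset.induction_on with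
  | empty => simpa using dirDeriv_C p w 0
  | insert e s he ih => rw [Finset.sum_insert he, Finset.sum_insert he, dirDeriv_add, ih]

/-- The chain rule for a polynomial along a differentiable curve. -/
theorem hasDerivAt_aeval_comp {u : ℝ → σ → ℂ} {w : σ → ℂ} {x : ℝ}
    (hu : ∀ j, HasDerivAt (fun y => u y j) (w j) x) (P : MvPolynomial σ ℚ) :
    HasDerivAt (fun y => aeval (u y) P) (dirDeriv (u x) w P) x := by
  classical
  induction P using MvPolynomial.induction_on with
  | C c => simpa using hasDerivAt_const x (c : ℂ)
  | add P Q hP hQ => simpa only [map_add, dirDeriv_add] using hP.fun_add hQ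
  | mul_X P n hP => simpa only [map_mul, dirDeriv_mul, dirDeriv_X, aeval_X] using hP.fun_mul (hu n)

variable {p w}

/-- At a singular point `p` of a vector field, an eigenvector `w` of the linear part of the field
makes the derivative in the direction `w` an eigenfunctional of the field. -/
theorem dirDeriv_derivation {V : Derivation ℚ (MvPolynomial σ ℚ) (MvPolynomial σ ℚ)} {l : ℂ}
    (hp : ∀ n, aeval p (V (X n)) = 0) (hw : ∀ n, dirDeriv p w (V (X n)) = l * w n)
    (P : MvPolynomial σ ℚ) :
    dirDeriv p w (V P) = l * dirDeriv p w P := by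
  classical
  -- Every V P vanishes at p, so the mixed terms of the Leibniz expansion drop out below.
  have hV : ∀ P, aeval p (V P) = 0 := by
    intro P
    induction P using MvPolynomial.induction_on with
    | C c => simp
    | add P Q hP hQ => simp [hP, hQ]
    | mul_X P n hP => simp [hP, hp]
  induction P using MvPolynomial.induction_on with
  | C c => simpa using dirDeriv_C p w 0
  | add P Q hP hQ => rw [map_add, dirDeriv_add, dirDeriv_add, hP, hQ, mul_add]
  | mul_X P n hP =>
    rw [Derivation.leibniz, dirDeriv_add, smul_eq_mul, smul_eq_mul, dirDeriv_mul, dirDeriv_mul,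
      dirDeriv_mul, hP, hw, hp, hV, dirDeriv_X]
    ring

theorem dirDeriv_iterate_derivation {V : Derivation ℚ (MvPolynomial σ ℚ) (MvPolynomial σ ℚ)}
    {l : ℂ} (hp : ∀ n, aeval p (V (X n)) = 0)
    (hw : ∀ n, dirDeriv p w (V (X n)) = l * w n) (P : MvPolynomial σ ℚ) (k : ℕ) :
    dirDeriv p w (V^[k] P) = l ^ k * dirDeriv p w P := by
  induction k with
  | zero => simp
  | succ k ih => rw [Function.iterate_succ_apply', dirDeriv_derivation hp hw, ih]; ring

end dirDeriv

/-! ## The singular points of the foliation -/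

/-- The affine coordinates of the singular point `g([1 : -r])`. -/
def singularPoint (r : ℂ) : Fin 4 → ℂ :=
  ![12 / (1 - r) ^ 2, 8 / (1 - r) ^ 3, 12 * r ^ 2 / (1 - r) ^ 2, -(8 * r ^ 3) / (1 - r) ^ 3]

theorem affine_g_one_neg (r : ℂ) :
    (g 1 (-r) (Or.inl one_ne_zero)).affine = singularPoint r := by
  have h : (g 1 (-r) (Or.inl one_ne_zero)).affine =
      ![3 * 1 ^ 2 / ((-r + 1) / 2) ^ 2, 1 ^ 3 / ((-r + 1) / 2) ^ 3,
        3 * (-r) ^ 2 / ((-r + 1) / 2) ^ 2, (-r) ^ 3 / ((-r + 1) / 2) ^ 3] := rfl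
  rw [h, singularPoint, neg_add_eq_sub]
  funext j
  fin_cases j <;> simp [div_pow, div_div_eq_mul_div] <;> ring

/-- The direction of the branch of the modular curve at `singularPoint r`. -/
def branchDirection (r : ℂ) : Fin 4 → ℂ :=
  ![(6 - 5 * r) * (1 - r), 7 * r - 6, r ^ 2 * (1 - r), -r ^ 3]

theorem aeval_singularPoint_v {r : ℂ} (hr : r ≠ 1) (n : Fin 4) :
    aeval (singularPoint r) (v (X n)) = 0 := by
  have h : 1 - r ≠ 0 := sub_ne_zero.mpr hr.symm
  fin_cases n <;> simp [v, mkDerivation_X, singularPoint] <;> field_simp <;> ring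

theorem dirDeriv_singularPoint_v {r : ℂ} (hr : r ≠ 1) (n : Fin 4) :
    dirDeriv (singularPoint r) (branchDirection r) (v (X n)) =
      12 / (1 - r) * branchDirection r n := by
  have h : 1 - r ≠ 0 := sub_ne_zero.mpr hr.symm
  have h2 (j : Fin 4) : pderiv j (2 : MvPolynomial (Fin 4) ℚ) = 0 := (pderiv j).map_natCast 2
  have h3 (j : Fin 4) : pderiv j (3 : MvPolynomial (Fin 4) ℚ) = 0 := (pderiv j).map_natCast 3
  have h6 (j : Fin 4) : pderiv j (6 : MvPolynomial (Fin 4) ℚ) = 0 := (pderiv j).map_natCast 6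
  fin_cases n <;>
    simp [v, mkDerivation_X, singularPoint, branchDirection, dirDeriv, Fin.sum_univ_four,
      pderiv_X, Pi.single_apply, pow_two, h2, h3, h6] <;>
    field_simp <;> ring

/-! ## The matrices `B` -/

/-- The polynomial `Q_{d,i}` in the affine chart. -/
def affineQ (d : ℕ+) (i : ℕ) (c : expSet d i → ℚ) : MvPolynomial (Fin 4) ℚ :=
  ∑ e, C (c e) * alpha i e.1

theorem aeval_affineQ (d : ℕ+) (i : ℕ) (c : expSet d i → ℚ) (u : Fin 4 → ℂ) :
    aeval u (affineQ d i c) = aeval ![u 0, u 1, u 2, u 3, 1] (Qpoly d i c) := by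
  have h (P : MvPolynomial (Fin 5) ℚ) :
      aeval u (aeval ![X 0, X 1, X 2, X 3, (1 : MvPolynomial (Fin 4) ℚ)] P) =
        aeval ![u 0, u 1, u 2, u 3, 1] P := by
    rw [← AlgHom.comp_apply]
    congr 1
    ext j
    fin_cases j <;> simp
  simp only [affineQ, Qpoly, alpha, map_sum, map_mul, h, aeval_C]

theorem iterate_v_affineQ (d : ℕ+) (i : ℕ) (c : expSet d i → ℚ) (k : ℕ) :
    v^[k] (affineQ d i c) = ∑ e, C (c e) * v^[k] (alpha i e.1) := by
  induction k with
  | zero => rfl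
  | succ k ih =>
    rw [Function.iterate_succ_apply', ih]
    simp [Function.iterate_succ_apply']

theorem dB_combination_mulVec (d : ℕ+) (i : ℕ) (c : expSet d i → ℚ) (p w : Fin 4 → ℂ)
    (k : Fin (expSet d i).card) :
    (∑ j, w j • dB d i j p).mulVec (fun e => (c e : ℂ)) k =
      dirDeriv p w (v^[(k : ℕ)] (affineQ d i c)) := by
  rw [iterate_v_affineQ, dirDeriv_sum]
  simp only [Matrix.mulVec, dotProduct, Matrix.sum_apply]
  refine Finset.sum_congr rfl fun e _ => ?_
  rw [dirDeriv_C_mul, mul_comm]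
  rfl

/-! ## Eisenstein series as power series -/

open ArithmeticFunction

/-- The power series `1 + C ∑ σ_k(n) qⁿ`. -/
def sigmaSeries (k : ℕ) (C q : ℂ) : ℂ := 1 + C * ∑' n : ℕ+, (sigma k n : ℂ) * q ^ (n : ℕ)

@[simp]
theorem sigmaSeries_zero (k : ℕ) (C : ℂ) : sigmaSeries k C 0 = 1 := by
  simp [sigmaSeries]

/-- Factoring out q leaves a series H with H(0) = σ_k(1) = 1. Continuity of H at 0 suffices, since
the slope of q H(q) at 0 is H(q); no termwise differentiation is needed. -/
theorem hasDerivAt_sigmaSeries_zero (k : ℕ) (C : ℂ) : HasDerivAt (sigmaSeries k C) C 0 := by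
  set H : ℂ → ℂ := fun q => ∑' n : ℕ, (sigma k (n + 1) : ℂ) * q ^ n with hH
  have hs : sigmaSeries k C = fun q => 1 + C * (q * H q) := by
    funext q
    rw [sigmaSeries, hH, tsum_pnat_eq_tsum_succ (f := fun n : ℕ => (sigma k n : ℂ) * q ^ n)]
    simp only
    rw [← tsum_mul_left (a := q)]
    congr 2
    refine tsum_congr fun n => ?_
    rw [pow_succ]; ring
  have hcont : ContinuousOn H (Metric.closedBall 0 (1 / 2)) := by
    -- Weierstrass test on the disc of radius 1/2, with σ_k(m) ≤ m^(k+1).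
    refine continuousOn_tsum (u := fun n : ℕ => ((n + 1 : ℕ) : ℝ) ^ (k + 1) * (1 / 2) ^ n)
      (fun n => by fun_prop) ?_ ?_
    · have h := summable_pow_mul_geometric_of_norm_lt_one (k + 1) (r := (1 / 2 : ℝ)) (by norm_num)
      -- The factor 2 compensates the extra 1/2 produced by the index shift.
      refine (((summable_nat_add_iff 1).mpr h).mul_left 2).congr fun n => ?_
      rw [pow_succ (1 / 2 : ℝ) n]; ring
    · intro n q hq
      rw [norm_mul, Complex.norm_natCast, norm_pow]
      gcongr
      · exact_mod_cast sigma_le_pow_succ k (n + 1)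
      · simpa using hq
  have hH0 : H 0 = 1 := by
    rw [hH]
    simp only
    rw [tsum_eq_single 0 (fun n hn => by simp [hn])]
    simp
  have hc : ContinuousAt H 0 :=
    hcont.continuousAt (Metric.closedBall_mem_nhds 0 (by norm_num))
  have hd : HasDerivAt (fun q => q * H q) 1 0 := by
    rw [hasDerivAt_iff_tendsto_slope]
    have h1 : Filter.Tendsto H (nhdsWithin 0 {0}ᶜ) (nhds 1) := by
      rw [← hH0]; exact hc.tendsto.mono_left nhdsWithin_le_nhds
    refine h1.congr' ?_
    filter_upwards [self_mem_nhdsWithin] with q hq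
    have hq : q ≠ 0 := hq
    simp [slope_def_field, hq]
  rw [hs]
  simpa using (hd.const_mul C).const_add 1

theorem E2_eq_sigmaSeries (τ : ℍ) :
    EisensteinSeries.E2 τ = sigmaSeries 1 (-24) (Complex.exp (2 * Real.pi * Complex.I * τ)) := by
  rw [EisensteinSeries.E2_eq_tsum_cexp, sigmaSeries]
  simp [sub_eq_add_neg]

theorem E4_eq_sigmaSeries (τ : ℍ) :
    ModularForm.E (k := 4) (by norm_num) τ =
      sigmaSeries 3 240 (Complex.exp (2 * Real.pi * Complex.I * τ)) := by
  have h : bernoulli 4 = -1 / 30 := by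
    rw [bernoulli_eq_bernoulli'_of_ne_one (by norm_num), bernoulli'_four]
  rw [EisensteinSeries.q_expansion_bernoulli (by norm_num) (by decide), sigmaSeries, h]
  norm_num

theorem E6_eq_sigmaSeries (τ : ℍ) :
    ModularForm.E (k := 6) (by norm_num) τ =
      sigmaSeries 5 (-504) (Complex.exp (2 * Real.pi * Complex.I * τ)) := by
  have h : bernoulli 6 = 1 / 42 := by
    rw [bernoulli_eq_bernoulli'_of_ne_one (by norm_num), bernoulli'_def]
    norm_num [Finset.sum_range_succ, Nat.choose, bernoulli'_four, bernoulli'_three,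
      bernoulli'_two, bernoulli'_one, bernoulli'_zero,
      bernoulli'_eq_zero_of_odd (show Odd 5 by decide)]
  rw [EisensteinSeries.q_expansion_bernoulli (by norm_num) (by decide), sigmaSeries, h]
  norm_num [sub_eq_add_neg]

/-! ### Translation and inversion of Eisenstein series -/

theorem exp_two_pi_I_add_int (z : ℂ) (n : ℤ) :
    Complex.exp (2 * Real.pi * Complex.I * (z + n)) = Complex.exp (2 * Real.pi * Complex.I * z) := by
  rw [Complex.exp_eq_exp_iff_exists_int]
  exact ⟨n, by ring⟩

/-- Encoding inversion as a product equal to -1 lets successive inversions and translations be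
composed by polynomial identities. -/
theorem S_smul_eq_of_mul_eq_neg_one {z w : ℍ} (h : (w : ℂ) * z = -1) : w = ModularGroup.S • z := by
  ext
  rw [modular_S_smul]
  change (w : ℂ) = (-(z : ℂ))⁻¹
  rw [inv_neg, eq_neg_iff_add_eq_zero]
  have := z.ne_zero
  field_simp
  rw [h]; ring

theorem E_eq_pow_mul_of_mul_eq_neg_one {k : ℕ} (hk : 3 ≤ k) {z w : ℍ} (h : (w : ℂ) * z = -1) :
    ModularForm.E hk w = (z : ℂ) ^ k * ModularForm.E hk z := by
  have hS : SlashAction.map (k : ℤ) ModularGroup.S (ModularForm.E hk : ℍ → ℂ) =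
      ModularForm.E hk :=
    SlashInvariantFormClass.slash_action_eq (ModularForm.E hk) _ ⟨ModularGroup.S, rfl⟩
  have hz := congrFun hS z
  rw [SlashInvariantForm.slash_S_apply, zpow_neg, ← div_eq_mul_inv,
    div_eq_iff (zpow_ne_zero _ z.ne_zero), zpow_natCast] at hz
  rw [S_smul_eq_of_mul_eq_neg_one h, modular_S_smul, hz, mul_comm]

/-- The additive term is the quasimodular correction; its constant comes from `D2_S` and ζ(2) =
π²/6. -/
theorem E2_of_mul_eq_neg_one {z w : ℍ} (h : (w : ℂ) * z = -1) :
    EisensteinSeries.E2 w = (z : ℂ) ^ 2 * EisensteinSeries.E2 z +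
      6 / (Real.pi * Complex.I) * z := by
  have hz := z.ne_zero
  have hS := congrFun (EisensteinSeries.E2_slash_action ModularGroup.S) z
  rw [SlashInvariantForm.slash_S_apply] at hS
  rw [S_smul_eq_of_mul_eq_neg_one h, modular_S_smul]
  simp only [Pi.sub_apply, Pi.smul_apply, EisensteinSeries.D2_S, smul_eq_mul,
    riemannZeta_two] at hS
  have hpi : (Real.pi : ℂ) ≠ 0 := by exact_mod_cast Real.pi_ne_zero
  rw [zpow_neg, ← div_eq_mul_inv, div_eq_iff (zpow_ne_zero _ hz)] at hS
  rw [hS]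
  field_simp
  linear_combination (-6 : ℂ) * Complex.I_sq

/-! ## The branch of `S₀(d)` at the cusp given by `d = a b` -/

theorem E2_eq_of_coe_eq_add_int {z w : ℍ} (n : ℤ) (h : (w : ℂ) = z + n) :
    EisensteinSeries.E2 w = EisensteinSeries.E2 z := by
  rw [E2_eq_sigmaSeries, E2_eq_sigmaSeries, h, exp_two_pi_I_add_int]

theorem E4_eq_of_coe_eq_add_int {z w : ℍ} (n : ℤ) (h : (w : ℂ) = z + n) :
    ModularForm.E (k := 4) (by norm_num) w = ModularForm.E (k := 4) (by norm_num) z := by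
  rw [E4_eq_sigmaSeries, E4_eq_sigmaSeries, h, exp_two_pi_I_add_int]

theorem E6_eq_of_coe_eq_add_int {z w : ℍ} (n : ℤ) (h : (w : ℂ) = z + n) :
    ModularForm.E (k := 6) (by norm_num) w = ModularForm.E (k := 6) (by norm_num) z := by
  rw [E6_eq_sigmaSeries, E6_eq_sigmaSeries, h, exp_two_pi_I_add_int]

theorem coe_S_smul_mul (z : ℍ) : ((ModularGroup.S • z : ℍ) : ℂ) * z = -1 := by
  rw [modular_S_smul]
  change (-(z : ℂ))⁻¹ * z = -1
  rw [inv_neg, neg_mul, inv_mul_cancel₀ z.ne_zero]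

/-- The affine point `[12 e₄ : 8 e₆ : 12 r² f₄ : -8 r³ f₆ : e₂ - r f₂]`. -/
def branchPoint (r e₂ e₄ e₆ f₂ f₄ f₆ : ℂ) : Fin 4 → ℂ :=
  ![12 * e₄ / (e₂ - r * f₂) ^ 2, 8 * e₆ / (e₂ - r * f₂) ^ 3,
    12 * r ^ 2 * f₄ / (e₂ - r * f₂) ^ 2, -(8 * r ^ 3 * f₆) / (e₂ - r * f₂) ^ 3]

/-- The point of the chart `y₁ ≠ 0` with given affine coordinates. -/
def ofAffine (u : Fin 4 → ℂ) : WProj :=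
  WProj.mk ![u 0, u 1, u 2, u 3, 1] fun h => by simpa using congrFun h 4

/-- The modular parametrization is evaluated at z = τ/(aτ + 1), which tends to the cusp 1/a as τ →
i∞. Then dz = b - 1/σ, so the Eisenstein series at z and dz are expressed through τ and σ. -/
theorem ofAffine_branchPoint_mem_S₀ {d a b : ℕ+} (hd : d = a * b) {r : ℂ}
    (hr : r = (a : ℂ) / (b : ℂ)) {τ σ : ℍ} (hσ : (b : ℂ) * σ = a * τ + 1)
    (hN : EisensteinSeries.E2 τ - r * EisensteinSeries.E2 σ ≠ 0) :
    ofAffine (branchPoint r (EisensteinSeries.E2 τ) (ModularForm.E (k := 4) (by norm_num) τ)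
      (ModularForm.E (k := 6) (by norm_num) τ) (EisensteinSeries.E2 σ)
      (ModularForm.E (k := 4) (by norm_num) σ) (ModularForm.E (k := 6) (by norm_num) σ)) ∈
        S₀ d := by
  have ha : (a : ℂ) ≠ 0 := by simp
  have hb : (b : ℂ) ≠ 0 := by simp
  have hdc : (d : ℂ) = a * b := by simp [hd]
  have hτ0 := τ.ne_zero
  have hσ0 := σ.ne_zero
  set t : ℍ := ModularGroup.S • τ with ht
  have htτ : (t : ℂ) * τ = -1 := coe_S_smul_mul τ
  set u : ℍ := (-(a : ℝ)) +ᵥ t with hu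
  have hut : (u : ℂ) = t + ((-(a : ℤ) : ℤ) : ℂ) := by
    rw [hu, coe_vadd]; push_cast; ring
  have huτ : (u : ℂ) * τ = -(b * σ) := by
    rw [hut, hσ]; push_cast; linear_combination htτ
  set z : ℍ := ModularGroup.S • u with hz
  have hzu : (z : ℂ) * u = -1 := coe_S_smul_mul u
  set ρ : ℍ := ModularGroup.S • σ with hρ
  have hρσ : (ρ : ℂ) * σ = -1 := coe_S_smul_mul σ
  have hzτ : (z : ℂ) * (b * σ) = τ := by linear_combination (-(τ : ℂ)) * hzu + (z : ℂ) * huτ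
  have hdz : (dilate d z : ℂ) = ρ + ((b : ℤ) : ℂ) := by
    have h1 : (dilate d z : ℂ) = d * z := rfl
    rw [h1, hdc]
    apply mul_right_cancel₀ hσ0
    push_cast
    linear_combination (a : ℂ) * hzτ - hρσ - hσ
  have hj : (u : ℂ) = -(b * σ) / τ := by rw [eq_div_iff hτ0, huτ]
  have e2z : EisensteinSeries.E2 z = (b * σ) ^ 2 * EisensteinSeries.E2 τ +
      6 / (Real.pi * Complex.I) * (a * (b * σ)) := by
    rw [E2_of_mul_eq_neg_one hzu, E2_eq_of_coe_eq_add_int _ hut, E2_of_mul_eq_neg_one htτ]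
    have h1 : (u : ℂ) ^ 2 * ((τ : ℂ) ^ 2 * EisensteinSeries.E2 τ +
        6 / (Real.pi * Complex.I) * τ) + 6 / (Real.pi * Complex.I) * u =
        (u * τ) ^ 2 * EisensteinSeries.E2 τ + 6 / (Real.pi * Complex.I) * (u * (u * τ + 1)) := by
      ring
    rw [h1, huτ, hj, hσ]
    field_simp
    ring
  have e2d : EisensteinSeries.E2 (dilate d z) = (σ : ℂ) ^ 2 * EisensteinSeries.E2 σ +
      6 / (Real.pi * Complex.I) * σ := by
    rw [E2_eq_of_coe_eq_add_int _ hdz, E2_of_mul_eq_neg_one hρσ]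
  have e4z : ModularForm.E (k := 4) (by norm_num) z =
      (b * σ) ^ 4 * ModularForm.E (k := 4) (by norm_num) τ := by
    rw [E_eq_pow_mul_of_mul_eq_neg_one _ hzu, E4_eq_of_coe_eq_add_int _ hut,
      E_eq_pow_mul_of_mul_eq_neg_one _ htτ, ← mul_assoc, ← mul_pow, huτ]
    ring
  have e6z : ModularForm.E (k := 6) (by norm_num) z =
      (b * σ) ^ 6 * ModularForm.E (k := 6) (by norm_num) τ := by
    rw [E_eq_pow_mul_of_mul_eq_neg_one _ hzu, E6_eq_of_coe_eq_add_int _ hut,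
      E_eq_pow_mul_of_mul_eq_neg_one _ htτ, ← mul_assoc, ← mul_pow, huτ]
    ring
  have e4d : ModularForm.E (k := 4) (by norm_num) (dilate d z) =
      (σ : ℂ) ^ 4 * ModularForm.E (k := 4) (by norm_num) σ := by
    rw [E4_eq_of_coe_eq_add_int _ hdz, E_eq_pow_mul_of_mul_eq_neg_one _ hρσ]
  have e6d : ModularForm.E (k := 6) (by norm_num) (dilate d z) =
      (σ : ℂ) ^ 6 * ModularForm.E (k := 6) (by norm_num) σ := by
    rw [E6_eq_of_coe_eq_add_int _ hdz, E_eq_pow_mul_of_mul_eq_neg_one _ hρσ]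
  set N := EisensteinSeries.E2 τ - r * EisensteinSeries.E2 σ with hNdef
  -- The scaling factor is forced by the coordinate y₁, which is normalized to 1.
  set l : ℂ := 2 * Real.pi * Complex.I / 12 * (b * σ) ^ 2 * N with hl
  have hl0 : l ≠ 0 := by
    refine mul_ne_zero (mul_ne_zero ?_ (pow_ne_zero _ (mul_ne_zero hb hσ0))) hN
    exact div_ne_zero Complex.two_pi_I_ne_zero (by norm_num)
  -- The quasimodular corrections of E₂(z) and d E₂(dz) are both proportional to abσ and cancel.
  have h4 : modularVec d z 4 = l := by
    have h : modularVec d z 4 = g₁ z - (d : ℂ) * g₁ (dilate d z) := rfl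
    rw [h, g₁, g₁, e2z, e2d, hl, hNdef, hr, hdc]
    field_simp
    ring
  have hne : modularVec d z ≠ 0 := fun h => hl0 (by rw [← h4, h]; rfl)
  refine subset_closure ⟨z, hne, Quotient.sound ⟨l, hl0, fun k => ?_⟩⟩
  change modularVec d z k = _
  fin_cases k
  · change g₂ z = l ^ 2 * (_ / N ^ 2)
    rw [g₂, e4z, hl]
    field_simp
  · change g₃ z = l ^ 3 * (_ / N ^ 3)
    rw [g₃, e6z, hl]
    field_simp
  · change (d : ℂ) ^ 2 * g₂ (dilate d z) = l ^ 2 * (_ / N ^ 2)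
    rw [g₂, e4d, hl, hr, hdc]
    field_simp
  · change -((d : ℂ) ^ 3 * g₃ (dilate d z)) = l ^ 3 * (_ / N ^ 3)
    rw [g₃, e6d, hl, hr, hdc]
    field_simp
  · change modularVec d z 4 = l ^ 1 * 1
    rw [h4]; ring

theorem aeval_affineQ_eq_zero {d : ℕ+} {i : ℕ} {c : expSet d i → ℚ} (hc : IsCoeffVector d i c)
    {u : Fin 4 → ℂ} (hu : ofAffine u ∈ S₀ d) : aeval u (affineQ d i c) = 0 := by
  rw [aeval_affineQ]
  exact hc.vanishes _ _ hu

/-- The branch of `S₀(ab)` at the cusp, in the real parameter `x = exp (2πiτ)`. -/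
def branch (a b : ℕ+) (x : ℝ) : Fin 4 → ℂ :=
  let y : ℂ := Complex.exp (2 * Real.pi * Complex.I * (1 / b)) * (x ^ ((a : ℝ) / b) : ℝ)
  branchPoint (a / b) (sigmaSeries 1 (-24) x) (sigmaSeries 3 240 x) (sigmaSeries 5 (-504) x)
    (sigmaSeries 1 (-24) y) (sigmaSeries 3 240 y) (sigmaSeries 5 (-504) y)

theorem ofAffine_branch_mem_S₀ {a b : ℕ+} {x : ℝ} (hx0 : 0 < x) (hx1 : x < 1)
    (hN : sigmaSeries 1 (-24) x - (a / b : ℂ) * sigmaSeries 1 (-24)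
      (Complex.exp (2 * Real.pi * Complex.I * (1 / b)) * (x ^ ((a : ℝ) / b) : ℝ)) ≠ 0) :
    ofAffine (branch a b x) ∈ S₀ (a * b) := by
  have hpi : (Real.pi : ℂ) ≠ 0 := by exact_mod_cast Real.pi_ne_zero
  have hb : (b : ℂ) ≠ 0 := by simp
  have ht : 0 < -Real.log x / (2 * Real.pi) :=
    div_pos (neg_pos.mpr (Real.log_neg hx0 hx1)) Real.two_pi_pos
  -- The point of the imaginary axis with nome x; below, σ = (aτ + 1)/b.
  let τ : ℍ := ⟨((-Real.log x / (2 * Real.pi) : ℝ) : ℂ) * Complex.I, by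
    rwa [Complex.im_ofReal_mul, Complex.I_im, mul_one]⟩
  have hτ : (τ : ℂ) = ((-Real.log x / (2 * Real.pi) : ℝ) : ℂ) * Complex.I := rfl
  let σ : ℍ := ⟨(((a : ℝ) / b : ℝ) : ℂ) * τ + ((1 / b : ℝ) : ℂ), by
    rw [Complex.add_im, Complex.im_ofReal_mul, Complex.ofReal_im, add_zero]
    exact mul_pos (div_pos (by simp) (by simp)) τ.im_pos⟩
  have hσ : (σ : ℂ) = (((a : ℝ) / b : ℝ) : ℂ) * τ + ((1 / b : ℝ) : ℂ) := rfl
  have hqτ : Complex.exp (2 * Real.pi * Complex.I * τ) = x := by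
    have h1 : 2 * Real.pi * Complex.I * (τ : ℂ) = (Real.log x : ℝ) := by
      rw [hτ]
      push_cast
      field_simp
      rw [Complex.I_sq]; ring
    rw [h1, ← Complex.ofReal_exp, Real.exp_log hx0]
  have hqσ : Complex.exp (2 * Real.pi * Complex.I * σ) =
      Complex.exp (2 * Real.pi * Complex.I * (1 / b)) * (x ^ ((a : ℝ) / b) : ℝ) := by
    have h1 : 2 * Real.pi * Complex.I * (σ : ℂ) = 2 * Real.pi * Complex.I * (1 / b) +
        (Real.log x * ((a : ℝ) / b) : ℝ) := by
      rw [hσ, hτ]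
      push_cast
      field_simp
      linear_combination (-(a * Real.log x) : ℂ) * Complex.I_sq
    rw [h1, Complex.exp_add, ← Complex.ofReal_exp, Real.rpow_def_of_pos hx0]
  have hστ : (b : ℂ) * σ = a * τ + 1 := by
    rw [hσ]
    push_cast
    field_simp
  have := ofAffine_branchPoint_mem_S₀ (d := a * b) rfl rfl hστ
    (by simpa only [E2_eq_sigmaSeries, hqτ, hqσ] using hN)
  simpa only [E2_eq_sigmaSeries, E4_eq_sigmaSeries, E6_eq_sigmaSeries, hqτ, hqσ, branch] using this

/-! ### The tangent vector of the branch at the cusp -/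

section derivative

variable {a b : ℕ+}

theorem one_lt_div_of_pnat_lt (hba : b < a) : 1 < (a : ℝ) / b := by
  rw [one_lt_div (by simp)]
  exact_mod_cast hba

theorem div_ne_one_of_pnat_lt (hba : b < a) : (a : ℂ) / b ≠ 1 := by
  intro h
  exact (one_lt_div_of_pnat_lt hba).ne' (Complex.ofReal_injective (by push_cast; exact h))

theorem branch_zero (a b : ℕ+) : branch a b 0 = singularPoint (a / b) := by
  have h : (a : ℝ) / b ≠ 0 := div_ne_zero (by simp) (by simp)
  funext j
  fin_cases j <;> simp [branch, branchPoint, singularPoint, Real.zero_rpow h]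

theorem hasDerivAt_sigmaSeries_ofReal (k : ℕ) (C : ℂ) :
    HasDerivAt (fun x : ℝ => sigmaSeries k C x) C 0 := by
  have h := hasDerivAt_sigmaSeries_zero k C
  rw [← Complex.ofReal_zero] at h
  exact h.comp_ofReal

/-- Since s > 1, x^s has zero derivative at 0. This is where b < a enters the tangent computation.
-/
theorem hasDerivAt_sigmaSeries_rpow (k : ℕ) (C ζ : ℂ) {s : ℝ} (hs : 1 < s) :
    HasDerivAt (fun x : ℝ => sigmaSeries k C (ζ * (x ^ s : ℝ))) 0 0 := by
  have h0 : (0 : ℝ) ^ s = 0 := Real.zero_rpow (by positivity)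
  have h1 : HasDerivAt (fun x : ℝ => x ^ s) 0 0 := by
    have h := Real.hasDerivAt_rpow_const (x := 0) (p := s) (Or.inr hs.le)
    rwa [Real.zero_rpow (sub_ne_zero.mpr hs.ne'), mul_zero] at h
  have h2 : HasDerivAt (fun x : ℝ => ζ * ((x ^ s : ℝ) : ℂ)) (ζ * ((0 : ℝ) : ℂ)) 0 :=
    h1.ofReal_comp.const_mul ζ
  have h3 : HasDerivAt (sigmaSeries k C) C (ζ * (((0 : ℝ) ^ s : ℝ) : ℂ)) := by
    rw [h0, Complex.ofReal_zero, mul_zero]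
    exact hasDerivAt_sigmaSeries_zero k C
  have h4 := h3.comp (0 : ℝ) h2
  rw [Complex.ofReal_zero, mul_zero, mul_zero] at h4
  exact h4

theorem hasDerivAt_branch_denom (hba : b < a) :
    HasDerivAt (fun x : ℝ => sigmaSeries 1 (-24) x - (a / b : ℂ) * sigmaSeries 1 (-24)
      (Complex.exp (2 * Real.pi * Complex.I * (1 / b)) * (x ^ ((a : ℝ) / b) : ℝ))) (-24) 0 := by
  simpa using (hasDerivAt_sigmaSeries_ofReal 1 (-24)).fun_sub
    ((hasDerivAt_sigmaSeries_rpow 1 (-24) _ (one_lt_div_of_pnat_lt hba)).const_mul (a / b : ℂ))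

/-- Quotient rule. The last two coordinates move only through the denominator. The common factor
576/(1 - r)^4 clears denominators, leaving a polynomial direction. -/
theorem hasDerivAt_branchPoint {r : ℂ} (hr : r ≠ 1) {e₂ e₄ e₆ f₂ f₄ f₆ : ℝ → ℂ}
    (he₂ : HasDerivAt e₂ (-24) 0) (he₄ : HasDerivAt e₄ 240 0) (he₆ : HasDerivAt e₆ (-504) 0)
    (hf₂ : HasDerivAt f₂ 0 0) (hf₄ : HasDerivAt f₄ 0 0) (hf₆ : HasDerivAt f₆ 0 0)
    (he₂' : e₂ 0 = 1) (he₄' : e₄ 0 = 1) (he₆' : e₆ 0 = 1)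
    (hf₂' : f₂ 0 = 1) (hf₄' : f₄ 0 = 1) (hf₆' : f₆ 0 = 1) (j : Fin 4) :
    HasDerivAt (fun x => branchPoint r (e₂ x) (e₄ x) (e₆ x) (f₂ x) (f₄ x) (f₆ x) j)
      (576 / (1 - r) ^ 4 * branchDirection r j) 0 := by
  have h : 1 - r ≠ 0 := sub_ne_zero.mpr hr.symm
  have hN : HasDerivAt (fun x => e₂ x - r * f₂ x) (-24) 0 := by
    simpa using he₂.fun_sub (hf₂.const_mul r)
  have hN0 (n : ℕ) : (e₂ 0 - r * f₂ 0) ^ n ≠ 0 := by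
    simpa [he₂', hf₂'] using pow_ne_zero n h
  fin_cases j
  · refine ((he₄.const_mul 12).fun_div (hN.fun_pow 2) (hN0 2)).congr_deriv ?_
    simp [branchDirection, he₂', hf₂', he₄']
    field_simp
    ring
  · refine ((he₆.const_mul 8).fun_div (hN.fun_pow 3) (hN0 3)).congr_deriv ?_
    simp [branchDirection, he₂', hf₂', he₆']
    field_simp
    ring
  · refine ((hf₄.const_mul (12 * r ^ 2)).fun_div (hN.fun_pow 2) (hN0 2)).congr_deriv ?_
    simp [branchDirection, he₂', hf₂', hf₄']
    field_simp
    ring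
  · refine ((hf₆.const_mul (8 * r ^ 3)).fun_neg.fun_div (hN.fun_pow 3) (hN0 3)).congr_deriv ?_
    simp [branchDirection, he₂', hf₂', hf₆']
    field_simp
    ring

theorem hasDerivAt_branch (hba : b < a) (j : Fin 4) :
    HasDerivAt (fun x => branch a b x j)
      (576 / (1 - (a / b : ℂ)) ^ 4 * branchDirection (a / b) j) 0 := by
  have hs := one_lt_div_of_pnat_lt hba
  have h0 : (a : ℝ) / b ≠ 0 := (one_pos.trans hs).ne'
  apply hasDerivAt_branchPoint (div_ne_one_of_pnat_lt hba) (hasDerivAt_sigmaSeries_ofReal _ _)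
    (hasDerivAt_sigmaSeries_ofReal _ _) (hasDerivAt_sigmaSeries_ofReal _ _)
    (hasDerivAt_sigmaSeries_rpow _ _ _ hs) (hasDerivAt_sigmaSeries_rpow _ _ _ hs)
    (hasDerivAt_sigmaSeries_rpow _ _ _ hs) <;> simp [Real.zero_rpow h0]

end derivative

/-! ### Vanishing of the derivative along the branch -/

theorem eventually_branch_mem_S₀ {a b : ℕ+} (hba : b < a) :
    ∀ᶠ x in nhdsWithin (0 : ℝ) (Set.Ioi 0), ofAffine (branch a b x) ∈ S₀ (a * b) := by
  have h0 : (a : ℝ) / b ≠ 0 := div_ne_zero (by simp) (by simp)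
  have hr : (1 : ℂ) - a / b ≠ 0 := sub_ne_zero.mpr (div_ne_one_of_pnat_lt hba).symm
  -- The denominator equals 1 - r ≠ 0 at x = 0, hence is nonzero nearby.
  have h1 := (hasDerivAt_branch_denom hba).continuousAt.eventually_ne
    (by simpa [Real.zero_rpow h0] using hr)
  filter_upwards [nhdsWithin_le_nhds h1, nhdsWithin_le_nhds (Iio_mem_nhds one_pos),
    self_mem_nhdsWithin] with x hN hx1 hx0
  exact ofAffine_branch_mem_S₀ hx0 hx1 hN

/-- A one-sided hypothesis is what is available: the branch is known to lie on the curve only for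
small x > 0. -/
theorem eq_zero_of_hasDerivAt_of_eventually_eq_zero {f : ℝ → ℂ} {f' : ℂ} {x : ℝ}
    (hf : HasDerivAt f f' x) (h : ∀ᶠ y in nhdsWithin x (Set.Ioi x), f y = 0) : f' = 0 := by
  have hx : f x = 0 := by
    refine tendsto_nhds_unique (hf.continuousAt.tendsto.mono_left nhdsWithin_le_nhds)
      (tendsto_const_nhds.congr' (f₁ := fun _ => (0 : ℂ)) (l₁ := nhdsWithin x (Set.Ioi x)) ?_)
    filter_upwards [h] with y hy using hy.symm
  have h1 : HasDerivWithinAt f 0 (Set.Ioi x) x :=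
    (hasDerivWithinAt_const x _ (0 : ℂ)).congr_of_eventuallyEq h hx
  exact (uniqueDiffWithinAt_Ioi x).eq_deriv _ hf.hasDerivWithinAt h1

/-- The polynomial `Q_{d,i}` has vanishing derivative along the branch at the cusp. -/
theorem dirDeriv_affineQ_eq_zero {a b : ℕ+} (hba : b < a) {i : ℕ} {c : expSet (a * b) i → ℚ}
    (hc : IsCoeffVector (a * b) i c) :
    dirDeriv (singularPoint (a / b)) (branchDirection (a / b)) (affineQ (a * b) i c) = 0 := by
  have hr : (1 : ℂ) - a / b ≠ 0 := sub_ne_zero.mpr (div_ne_one_of_pnat_lt hba).symm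
  have h := eq_zero_of_hasDerivAt_of_eventually_eq_zero
    (hasDerivAt_aeval_comp (hasDerivAt_branch hba) (affineQ (a * b) i c))
    ((eventually_branch_mem_S₀ hba).mono fun x hx => aeval_affineQ_eq_zero hc hx)
  rw [branch_zero] at h
  simp only [dirDeriv, mul_assoc, ← Finset.mul_sum] at h
  -- Cancels the nonzero factor 576/(1 - r)^4 between the velocity and the chosen direction.
  exact (mul_eq_zero.mp h).resolve_left (div_ne_zero (by norm_num) (pow_ne_zero _ hr))

end ModularFoliation

end

theorem proposition3 (d a b : ℕ+) (hd : d = a * b) (hba : b < a)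
    (r : ℂ) (hr : r = (a : ℂ) / (b : ℂ))
    (p : Fin 4 → ℂ)
    (hp : p = (ModularFoliation.g 1 (-r) (Or.inl one_ne_zero)).affine)
    (i : ℕ) (hi : 1 ≤ i ∧ i ≤ 3)
    (c : ModularFoliation.expSet d i → ℚ) (hc : ModularFoliation.IsCoeffVector d i c) :
    (((6 - 5 * r) * (1 - r)) • ModularFoliation.dB d i 0 p
      + (7 * r - 6) • ModularFoliation.dB d i 1 p
      + (r ^ 2 * (1 - r)) • ModularFoliation.dB d i 2 p
      - r ^ 3 • ModularFoliation.dB d i 3 p).mulVec (fun e => (c e : ℂ)) = 0 := by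
  subst hd
  rw [ModularFoliation.affine_g_one_neg] at hp
  subst hp
  have hr1 : r ≠ 1 := hr ▸ ModularFoliation.div_ne_one_of_pnat_lt hba
  funext k
  have h := ModularFoliation.dB_combination_mulVec (a * b) i c (ModularFoliation.singularPoint r)
    (ModularFoliation.branchDirection r) k
  -- The eigenvalue relation reduces every row k to the single derivative of Q along the branch,
  -- which is zero.
  rw [ModularFoliation.dirDeriv_iterate_derivation
      (ModularFoliation.aeval_singularPoint_v hr1)
      (ModularFoliation.dirDeriv_singularPoint_v hr1), hr,
    ModularFoliation.dirDeriv_affineQ_eq_zero hba hc, mul_zero, ← hr, Fin.sum_univ_four] at h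
  simpa [ModularFoliation.branchDirection, sub_eq_add_neg] using h
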